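/- Let $\mathcal H$ be an infinite-dimensional complex Hilbert space and $A$ a bounded normal operator on $\mathcal H$. Let $\sigma_{\mathrm{dis}}(A)$ be the set of isolated points of $\sigma(A)$ that are eigenvalues of finite multiplicity, and $\sigma_{\mathrm{ess}}(A)=\sigma(A)\setminus\sigma_{\mathrm{dis}}(A)$. For $\Sigma\subset\mathbb C$ and $\varepsilon>0$ put $$[\Sigma]_\varepsilon=\{z:\operatorname{dist}[z,\Sigma]\le\varepsilon\},\qquad \mathcal Q(\Sigma)=\big\{z\in\mathbb C:\ 0\in\operatorname{conv}\{(\lambda-z)(\overline\lambda-z):\lambda\in\Sigma\}\big\},$$ where $\operatorname{conv}$ is the closed convex hull. For subspaces $\mathcal L,\mathcal M\subset\mathcal H$ put $\delta(\mathcal L,\mathcal M)=\sup\{\operatorname{dist}[\psi,\mathcal M]:\psi\in\mathcal L,\ \|\psi\|=1\}$ (and $\delta(\{0\},\mathcal M)=0$). Let $\mathcal L\subset\mathcal H$ be a finite-dimensional subspace with orthogonal projection $P$, let $\varepsilon>0$, and let $\sigma(A)\setminus[\sigma_{\mathrm{ess}}(A)]_\varepsilon=\{z_1,\dots,z_m\}$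 ($m\ge 0$). Let $\mathcal L(\{z_1,\dots,z_m\})$ be the linear hull of the eigenspaces $\ker(A-z_j)$, $1\le j\le m$. Put $M_0=\max\{|e-z_j|:e\in\sigma_{\mathrm{ess}}(A),\,1\le j\le m\}$ and \begin{align*} f_1(z)&=\max\{|z-z_j|,|z-\overline z_j|:1\le j\le m\}, & f_2(z)&=\min\{|z-z_j||z-\overline z_j|:1\le j\le m\},\\ f_3(z)&=\max\{|z-e||z-\overline e|:e\in\sigma_{\mathrm{ess}}(A)\}, & f_4(z)&=\min\{|z-e||z-\overline e|:e\in\sigma_{\mathrm{ess}}(A)\}, \end{align*} $$\alpha(z)=\min\Big\{1,\frac{f_2(z)}{f_3(z)}\Big\},\qquad \beta(z)=\frac{2M_0f_1(z)+M_0^2}{f_4(z)}\left(1+\frac{\|(A-z)(A^*-z)\|}{\operatorname{dist}[z,[\mathcal Q(\sigma_{\mathrm{ess}}(A))]_\varepsilon]^2}\right),$$ with the convention $\alpha(z)=1$, $\beta(z)=0$ if $m=0$. Then for every $z\notin\sigma(A)\cup\sigma(A^*)\cup[\mathcal Q(\sigma_{\mathrm{ess}}(A))]_\varepsilon$ and every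 $\psi\in\mathcal H$, $$\|P(A-z)(A^*-z)P\psi\|\ \ge\ \operatorname{dist}[z,[\mathcal Q(\sigma_{\mathrm{ess}}(A))]_\varepsilon]^2\,\big(\alpha(z)-\beta(z)\,\delta(\mathcal L(\{z_1,\dots,z_m\}),\mathcal L)\big)\,\|P\psi\|.$$ -/

import Mathlib

open ComplexConjugate

noncomputable section

namespace SecondOrder

/-- The set `Σ_z = {(λ - z)(conj λ - z) : λ ∈ Σ}`. -/
def quadSet (S : Set ℂ) (z : ℂ) : Set ℂ :=
  (fun l : ℂ => (l - z) * (conj l - z)) '' S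

/-- `Q(Σ) = {z : 0 ∈ conv(Σ_z)}`, with `conv` the closed convex hull. -/
def Q (S : Set ℂ) : Set ℂ :=
  {z : ℂ | (0 : ℂ) ∈ closedConvexHull ℝ (quadSet S z)}

variable {H : Type*} [NormedAddCommGroup H] [InnerProductSpace ℂ H]

/-- The eigenspace `ker (A - z)`. -/
def eigenspace (A : H →L[ℂ] H) (z : ℂ) : Submodule ℂ H :=
  Module.End.eigenspace (A : H →ₗ[ℂ] H) z

/-- The discrete spectrum of a (normal) operator: the isolated points of the spectrum that are
eigenvalues of finite multiplicity. -/
def discreteSpectrum (A : H →L[ℂ] H) : Set ℂ :=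
  {z : ℂ | (∃ r : ℝ, 0 < r ∧ Metric.ball z r ∩ spectrum ℂ A = {z}) ∧
    eigenspace A z ≠ ⊥ ∧ FiniteDimensional ℂ (eigenspace A z)}

/-- The essential spectrum of a (normal) operator: the rest of the spectrum. -/
def essSpectrum (A : H →L[ℂ] H) : Set ℂ :=
  spectrum ℂ A \ discreteSpectrum A

/-- The linear hull of the eigenspaces of `A` belonging to `z_1, …, z_m`. -/
def eigenHull (A : H →L[ℂ] H) {m : ℕ} (ζ : Fin m → ℂ) : Submodule ℂ H :=
  ⨆ j, eigenspace A (ζ j)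

/-- The one-sided gap `δ(L, M) = sup {dist(ψ, M) : ψ ∈ L, ‖ψ‖ = 1}`
(equal to `0` for `L = 0`, where the supremum is over the empty set). -/
def gap (L M : Submodule ℂ H) : ℝ :=
  sSup ((fun ψ : H => Metric.infDist ψ (M : Set H)) '' {ψ : H | ψ ∈ L ∧ ‖ψ‖ = 1})

/-- `M₀ = max {|e - z_j| : e ∈ σ_ess(A), 1 ≤ j ≤ m}`. -/
def M₀ (A : H →L[ℂ] H) {m : ℕ} (ζ : Fin m → ℂ) : ℝ :=
  sSup {r : ℝ | ∃ e ∈ essSpectrum A, ∃ j, r = ‖e - ζ j‖}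

/-- `f₁(z) = max {|z - z_j|, |z - conj z_j| : 1 ≤ j ≤ m}`. -/
def f₁ {m : ℕ} (ζ : Fin m → ℂ) (z : ℂ) : ℝ :=
  ⨆ j, max ‖z - ζ j‖ ‖z - conj (ζ j)‖

/-- `f₂(z) = min {|z - z_j| |z - conj z_j| : 1 ≤ j ≤ m}`, used only for `m ≥ 1`. -/
def f₂ {m : ℕ} (ζ : Fin m → ℂ) (z : ℂ) : ℝ :=
  ⨅ j, ‖z - ζ j‖ * ‖z - conj (ζ j)‖

/-- `f₃(z) = max {|z - e| |z - conj e| : e ∈ σ_ess(A)}`. -/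
def f₃ (A : H →L[ℂ] H) (z : ℂ) : ℝ :=
  sSup ((fun e : ℂ => ‖z - e‖ * ‖z - conj e‖) '' essSpectrum A)

/-- `f₄(z) = min {|z - e| |z - conj e| : e ∈ σ_ess(A)}`. -/
def f₄ (A : H →L[ℂ] H) (z : ℂ) : ℝ :=
  sInf ((fun e : ℂ => ‖z - e‖ * ‖z - conj e‖) '' essSpectrum A)

/-- `α(z) = min {1, f₂(z) / f₃(z)}`. For `m = 0` the minimum `f₂` over the empty set is `+∞`,
so that `α(z) = 1`. -/
def α (A : H →L[ℂ] H) {m : ℕ} (ζ : Fin m → ℂ) (z : ℂ) : ℝ :=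
  if m = 0 then 1 else min 1 (f₂ ζ z / f₃ A z)

variable [CompleteSpace H]

/-- The operator `(A - z)(A* - z)`. -/
def quadOp (A : H →L[ℂ] H) (z : ℂ) : H →L[ℂ] H :=
  (A - z • ContinuousLinearMap.id ℂ H) ∘L
    (ContinuousLinearMap.adjoint A - z • ContinuousLinearMap.id ℂ H)

/-- `dist[z, [Q(σ_ess(A))]_ε]`, where `[S]_ε = {w : dist(w, S) ≤ ε}`. -/
def distQ (A : H →L[ℂ] H) (ε : ℝ) (z : ℂ) : ℝ :=
  Metric.infDist z (Metric.cthickening ε (Q (essSpectrum A)))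

/-- `β(z) = (2 M₀ f₁(z) + M₀²) / f₄(z) * (1 + ‖(A - z)(A* - z)‖ / dist[z, [Q(σ_ess(A))]_ε]²)`. -/
def β (A : H →L[ℂ] H) (ε : ℝ) {m : ℕ} (ζ : Fin m → ℂ) (z : ℂ) : ℝ :=
  (2 * M₀ A ζ * f₁ ζ z + M₀ A ζ ^ 2) / f₄ A z * (1 + ‖quadOp A z‖ / distQ A ε z ^ 2)

end SecondOrder

end

/-! ### The quadratic form of a normal operator and its roots -/

namespace SecondOrder

open scoped ComplexOrder

variable {H : Type*} [NormedAddCommGroup H] [InnerProductSpace ℂ H]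

/-! For normal `B` and unit `φ`, `⟨φ, (B - z)(B* - z)φ⟩` is a real quadratic in `z` with roots `root
(±1) φ (Bφ)`. If the spectrum of `B` lies in `S`, both roots lie in `Q S` (`root_mem_Q`), and they
move by at most `‖B - B'‖` when `B` is replaced by `B'` (`dist_root_le`). Let `g` be a nearest point
map onto the essential spectrum, and let `f` equal `g` at the `z_j` and the identity elsewhere. Then
`‖f(A) - g(A)‖ ≤ ε`, so the form of `f(A)` is at least `dist² ‖φ‖²` in modulus
(`sq_infDist_le_norm_inner_cfc_quad`).

To return to `A`, put `q(l) = (l - z)(conj l - z)` and `c = α q(f) / q`, so that `c(A) q(A) = α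
q(f(A))`. For `φ` in `L`, the vector `u = c(A)* φ` is `α φ` plus an element of the eigenspace hull,
so its distance from `L` is controlled by the gap. Pairing `u` with `q(A) φ` and splitting `u` along
`L` gives the bound. -/

theorem norm_sub_re_inner_smul_sq {φ u : H} (hφ : ‖φ‖ = 1) :
    ‖u - ((inner ℂ φ u).re : ℂ) • φ‖ ^ 2 = ‖u‖ ^ 2 - (inner ℂ φ u).re ^ 2 := by
  rw [@norm_sub_sq ℂ, inner_smul_right, norm_smul, hφ, ← inner_conj_symm u φ]
  simp only [RCLike.re_to_complex, Complex.re_ofReal_mul, Complex.conj_re, Complex.norm_real,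
    Real.norm_eq_abs, mul_one, sq_abs]
  ring

/-- The two roots of `z ↦ ⟨φ, (B - z)(B* - z) φ⟩` for `u = B φ`. -/
noncomputable def root (s : ℝ) (φ u : H) : ℂ :=
  ⟨(inner ℂ φ u).re, s * ‖u - ((inner ℂ φ u).re : ℂ) • φ‖⟩

theorem sub_root_mul_sub_root {φ u : H} (hφ : ‖φ‖ = 1) (z : ℂ) :
    (z - root 1 φ u) * (z - root (-1) φ u) =
      ((‖u‖ ^ 2 : ℝ) : ℂ) - z * ((2 * (inner ℂ φ u).re : ℝ) : ℂ) + z ^ 2 := by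
  have h := norm_sub_re_inner_smul_sq (u := u) hφ
  rw [show ‖u‖ ^ 2 = ‖u - ((inner ℂ φ u).re : ℂ) • φ‖ ^ 2 + (inner ℂ φ u).re ^ 2 by rw [h]; ring]
  apply Complex.ext <;> simp [root, pow_two] <;> ring

/-- The two coordinates of a root are the real coefficient along `φ` and, up to sign, the norm of
the remainder. The reverse triangle inequality on remainders and the Pythagorean identity for `u -
v` combine to constant 1. -/
theorem dist_root_le {s : ℝ} (hs : s ^ 2 = 1) {φ u v : H} (hφ : ‖φ‖ = 1) :
    dist (root s φ u) (root s φ v) ≤ ‖u - v‖ := by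
  have h1 := norm_sub_re_inner_smul_sq (u := u - v) hφ
  have h2 := abs_norm_sub_norm_le (u - ((inner ℂ φ u).re : ℂ) • φ)
    (v - ((inner ℂ φ v).re : ℂ) • φ)
  have h3 : u - ((inner ℂ φ u).re : ℂ) • φ - (v - ((inner ℂ φ v).re : ℂ) • φ)
      = u - v - ((inner ℂ φ (u - v)).re : ℂ) • φ := by
    rw [inner_sub_right, Complex.sub_re, Complex.ofReal_sub, sub_smul]
    abel
  rw [h3] at h2
  have h4 := pow_le_pow_left₀ (abs_nonneg _) h2 2
  rw [sq_abs, h1, inner_sub_right, Complex.sub_re] at h4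
  rw [Complex.dist_eq]
  refine (sq_le_sq₀ (norm_nonneg _) (norm_nonneg _)).1 ?_
  rw [← Complex.normSq_eq_norm_sq, Complex.normSq_apply]
  simp only [root, Complex.sub_re, Complex.sub_im]
  nlinarith

variable [CompleteSpace H]

/-- The numerical range of `h(A)` lies in the closed convex hull of the values of `h`. -/
theorem inner_cfc_mem_closedConvexHull {A : H →L[ℂ] H} (hA : IsStarNormal A) {h : ℂ → ℂ}
    (hh : ContinuousOn h (spectrum ℂ A)) {S : Set ℂ} (hS : ∀ l ∈ spectrum ℂ A, h l ∈ S)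
    {φ : H} (hφ : ‖φ‖ = 1) : inner ℂ φ (cfc h A φ) ∈ closedConvexHull ℝ S := by
  by_contra hmem
  obtain ⟨F, u, hFu, hF⟩ := geometric_hahn_banach_point_closed
    (convex_closedConvexHull (𝕜 := ℝ) (s := S)) isClosed_closedConvexHull hmem
  -- Every real functional on `ℂ` is `w ↦ Re (c w)`. The separation thus becomes `Re (c h) > u` on
  -- the spectrum, which the functional calculus carries over to the numerical range.
  set c : ℂ := ⟨F 1, -F Complex.I⟩ with hc
  have hre (w : ℂ) : F w = (c * w).re := by
    have hw : w = w.re • (1 : ℂ) + w.im • Complex.I := by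
      simp [Complex.re_add_im]
    conv_lhs => rw [hw, map_add, map_smul, map_smul]
    simp [hc]
    ring
  have hcont : ContinuousOn (fun l => c * h l) (spectrum ℂ A) := continuousOn_const.mul hh
  have hpos : 0 ≤ cfc (fun l => c * h l + star (c * h l) - ((2 * u : ℝ) : ℂ)) A := by
    refine cfc_nonneg fun l hl => ?_
    have h1 := hF _ (subset_closedConvexHull (𝕜 := ℝ) (hS l hl))
    rw [hre] at h1
    have h2 : c * h l + star (c * h l) - ((2 * u : ℝ) : ℂ)
        = ((2 * (c * h l).re - 2 * u : ℝ) : ℂ) := by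
      have := Complex.add_conj (c * h l)
      rw [Complex.star_def, this]
      push_cast
      ring
    rw [h2, Complex.zero_le_real]
    linarith
  rw [cfc_sub (fun l => c * h l + star (c * h l)) _ A (hcont.add hcont.star) continuousOn_const,
    cfc_add A (fun l => c * h l) (fun l => star (c * h l)) hcont hcont.star, cfc_star,
    cfc_const_mul c h A hh, cfc_const _ A,
    ContinuousLinearMap.nonneg_iff_isPositive] at hpos
  have h3 := hpos.re_inner_nonneg_right φ
  have h4 : inner ℂ φ ((star (c • cfc h A)) φ) = conj (c * inner ℂ φ (cfc h A φ)) := by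
    rw [ContinuousLinearMap.star_eq_adjoint, ContinuousLinearMap.adjoint_inner_right,
      _root_.smul_apply, inner_smul_left, map_mul, inner_conj_symm]
  have h5 : inner ℂ φ ((algebraMap ℂ (H →L[ℂ] H) ((2 * u : ℝ) : ℂ)) φ) = ((2 * u : ℝ) : ℂ) := by
    rw [ContinuousLinearMap.algebraMap_apply, inner_smul_right, inner_self_eq_norm_sq_to_K, hφ]
    simp
  rw [_root_.sub_apply, _root_.add_apply, inner_sub_right,
    inner_add_right, h4, h5, _root_.smul_apply, inner_smul_right, Complex.add_conj,
    ← Complex.ofReal_sub] at h3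
  rw [hre] at hFu
  simp only [RCLike.re_to_complex, Complex.ofReal_re] at h3
  linarith

/-- The polynomial `(λ - z)(conj λ - z)`. -/
def quad (z l : ℂ) : ℂ := (l - z) * (conj l - z)

theorem quad_mul (z l : ℂ) : quad z l = star l * l - z * (l + star l) + z ^ 2 := by
  simp only [quad, Complex.star_def]
  ring

theorem continuous_quad (z : ℂ) : Continuous (quad z) := by
  unfold quad
  fun_prop

theorem norm_quad (z l : ℂ) : ‖quad z l‖ = ‖z - l‖ * ‖z - conj l‖ := by
  rw [quad, norm_mul, norm_sub_rev l, norm_sub_rev (conj l)]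

theorem quadOp_eq_cfc {A : H →L[ℂ] H} (hA : IsStarNormal A) (z : ℂ) :
    quadOp A z = cfc (quad z) A := by
  have h1 : quad z = fun l => (l - z) * (star l - z) := rfl
  rw [h1, cfc_mul _ _ A (by fun_prop) (by fun_prop), cfc_sub (fun l => l) _ A,
    cfc_sub (fun l => star l) _ A, cfc_star_id A, cfc_id' ℂ A, cfc_const z A]
  rfl

theorem inner_cfc_quad {A : H →L[ℂ] H} (hA : IsStarNormal A) {g : ℂ → ℂ}
    (hg : ContinuousOn g (spectrum ℂ A)) (z : ℂ) {φ : H} (hφ : ‖φ‖ = 1) :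
    inner ℂ φ (cfc (fun l => quad z (g l)) A φ) =
      ((‖cfc g A φ‖ ^ 2 : ℝ) : ℂ) - z * ((2 * (inner ℂ φ (cfc g A φ)).re : ℝ) : ℂ) + z ^ 2 := by
  have hs : ContinuousOn (fun l => star (g l)) (spectrum ℂ A) := hg.star
  have hsg : ContinuousOn (fun l => g l + star (g l)) (spectrum ℂ A) := hg.add hs
  simp only [quad_mul]
  rw [cfc_add A (fun l => star (g l) * g l - z * (g l + star (g l))) (fun _ => z ^ 2)
      ((hs.mul hg).sub (continuousOn_const.mul hsg)) continuousOn_const,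
    cfc_sub (fun l => star (g l) * g l) (fun l => z * (g l + star (g l))) A
      (hs.mul hg) (continuousOn_const.mul hsg),
    cfc_mul (fun l => star (g l)) g A hs hg, cfc_const_mul z _ A hsg,
    cfc_add A g (fun l => star (g l)) hg hs, cfc_star, cfc_const _ A]
  simp only [_root_.add_apply, _root_.sub_apply,
    _root_.smul_apply, mul_apply_eq_comp, inner_add_right,
    inner_sub_right, inner_smul_right, ContinuousLinearMap.star_eq_adjoint,
    ContinuousLinearMap.adjoint_inner_right, ContinuousLinearMap.algebraMap_apply,
    inner_self_eq_norm_sq_to_K, hφ]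
  rw [← inner_conj_symm (cfc g A φ) φ, Complex.add_conj]
  simp

/-- At a root the form vanishes, so `0` lies in the numerical range of `quad z (g(A))`, hence in the
closed convex hull of `quadSet S z`. -/
theorem root_mem_Q {A : H →L[ℂ] H} (hA : IsStarNormal A) {g : ℂ → ℂ}
    (hg : ContinuousOn g (spectrum ℂ A)) {S : Set ℂ} (hS : ∀ l ∈ spectrum ℂ A, g l ∈ S)
    {s : ℝ} (hs : s = 1 ∨ s = -1) {φ : H} (hφ : ‖φ‖ = 1) : root s φ (cfc g A φ) ∈ Q S := by
  have h := inner_cfc_mem_closedConvexHull hA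
    (h := fun l => quad (root s φ (cfc g A φ)) (g l)) ((continuous_quad _).comp_continuousOn hg)
    (S := quadSet S (root s φ (cfc g A φ))) (fun l hl => ⟨g l, hS l hl, rfl⟩) hφ
  rw [inner_cfc_quad hA hg _ hφ, ← sub_root_mul_sub_root hφ] at h
  rw [Q, Set.mem_ofPred_eq]
  rcases hs with rfl | rfl <;> simpa using h

/-- Lower bound for the quadratic form of a normal operator whose spectrum is within `ε` of `S`. -/
theorem sq_infDist_le_norm_inner_cfc_quad {A : H →L[ℂ] H} (hA : IsStarNormal A) {f g : ℂ → ℂ}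
    (hf : ContinuousOn f (spectrum ℂ A)) (hg : ContinuousOn g (spectrum ℂ A))
    {S : Set ℂ} (hS : ∀ l ∈ spectrum ℂ A, g l ∈ S) {ε : ℝ} (hε : 0 ≤ ε)
    (hfg : ∀ l ∈ spectrum ℂ A, ‖f l - g l‖ ≤ ε) (z : ℂ) (φ : H) :
    Metric.infDist z (Metric.cthickening ε (Q S)) ^ 2 * ‖φ‖ ^ 2 ≤
      ‖inner ℂ φ (cfc (fun l => quad z (f l)) A φ)‖ := by
  have key : ∀ χ : H, ‖χ‖ = 1 → Metric.infDist z (Metric.cthickening ε (Q S)) ^ 2 ≤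
      ‖inner ℂ χ (cfc (fun l => quad z (f l)) A χ)‖ := by
    intro χ hχ
    have hroot : ∀ s : ℝ, s = 1 ∨ s = -1 → Metric.infDist z (Metric.cthickening ε (Q S)) ≤
        ‖z - root s χ (cfc f A χ)‖ := by
      intro s hs
      rw [← dist_eq_norm]
      refine Metric.infDist_le_dist_of_mem
        (Metric.mem_cthickening_of_dist_le _ _ _ _ (root_mem_Q hA hg hS hs hχ) ?_)
      refine (dist_root_le (by rcases hs with rfl | rfl <;> norm_num) hχ).trans ?_
      rw [← _root_.sub_apply, ← cfc_sub f g A hf hg]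
      refine (ContinuousLinearMap.le_opNorm _ _).trans ?_
      rw [hχ, mul_one]
      exact norm_cfc_le hε hfg
    rw [inner_cfc_quad hA hf z hχ, ← sub_root_mul_sub_root hχ, norm_mul, pow_two]
    exact mul_le_mul (hroot 1 (Or.inl rfl)) (hroot (-1) (Or.inr rfl)) Metric.infDist_nonneg
      (norm_nonneg _)
  rcases eq_or_ne φ 0 with rfl | hφ
  · simp
  have hφ' : ‖φ‖ ≠ 0 := norm_ne_zero_iff.2 hφ
  have h := key (((‖φ‖⁻¹ : ℝ) : ℂ) • φ) (by
    rw [norm_smul, Complex.norm_real, norm_inv, norm_norm, inv_mul_cancel₀ hφ'])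
  rw [map_smul, inner_smul_left, inner_smul_right, norm_mul, norm_mul, RCLike.norm_conj,
    Complex.norm_real, norm_inv, norm_norm] at h
  calc _ ≤ _ := mul_le_mul_of_nonneg_right h (sq_nonneg ‖φ‖)
    _ = _ := by field_simp

end SecondOrder

/-! ### Isolated spectral points, the nearest point map and the gap -/

namespace SecondOrder

open Topology

variable {H : Type*} [NormedAddCommGroup H] [InnerProductSpace ℂ H]

theorem discreteSpectrum_isolated {A : H →L[ℂ] H} {z : ℂ} (hz : z ∈ discreteSpectrum A) :
    {z} ∈ 𝓝[spectrum ℂ A] z := by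
  obtain ⟨⟨r, hr, h⟩, -⟩ := hz
  rw [← h]
  exact Filter.inter_mem (mem_nhdsWithin_of_mem_nhds (Metric.ball_mem_nhds z hr))
    self_mem_nhdsWithin

theorem continuousWithinAt_of_mem_discreteSpectrum {A : H →L[ℂ] H} {z : ℂ}
    (hz : z ∈ discreteSpectrum A) (h : ℂ → ℂ) : ContinuousWithinAt h (spectrum ℂ A) z := by
  intro U hU
  refine Filter.mem_map.2 (Filter.mem_of_superset (discreteSpectrum_isolated hz) ?_)
  rw [Set.singleton_subset_iff, Set.mem_preimage]
  exact mem_of_mem_nhds hU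

/-- Changing a continuous function at finitely many isolated points keeps it continuous. -/
theorem continuousOn_ite_mem {A : H →L[ℂ] H} {Z : Set ℂ} [DecidablePred (· ∈ Z)]
    (hZ : Z ⊆ discreteSpectrum A) (hfin : Z.Finite) {h : ℂ → ℂ} (hh : ContinuousOn h (spectrum ℂ A)) (k : ℂ → ℂ) :
    ContinuousOn (fun l => if l ∈ Z then k l else h l) (spectrum ℂ A) := by
  intro l hl
  by_cases hlZ : l ∈ Z
  · exact continuousWithinAt_of_mem_discreteSpectrum (hZ hlZ) _
  · refine (hh l hl).congr_of_eventuallyEq ?_ (if_neg hlZ)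
    filter_upwards [mem_nhdsWithin_of_mem_nhds (hfin.isClosed.isOpen_compl.mem_nhds hlZ)] with y hy
    exact if_neg hy

/-- A nearest point map onto the essential spectrum is continuous on the spectrum. -/
theorem continuousOn_of_infDist_eq_dist {A : H →L[ℂ] H} {g : ℂ → ℂ}
    (hg : ∀ l, Metric.infDist l (essSpectrum A) = dist l (g l)) :
    ContinuousOn g (spectrum ℂ A) := by
  intro l hl
  by_cases hd : l ∈ discreteSpectrum A
  · exact continuousWithinAt_of_mem_discreteSpectrum hd g
  · have hle : l ∈ essSpectrum A := ⟨hl, hd⟩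
    have hgl : g l = l := by
      have h := hg l
      rw [Metric.infDist_zero_of_mem hle] at h
      exact (dist_eq_zero.1 h.symm).symm
    refine ContinuousAt.continuousWithinAt ?_
    rw [ContinuousAt, hgl, tendsto_iff_dist_tendsto_zero]
    -- A point `l` of the essential spectrum is fixed by `g` and is itself a candidate for the
    -- nearest point, so `dist (g y) l ≤ 2 * dist y l`. No continuous choice of `g` is needed.
    refine squeeze_zero (g := fun y => 2 * dist y l) (fun _ => dist_nonneg) (fun y => ?_) ?_
    · have h1 := Metric.infDist_le_dist_of_mem (x := y) hle
      rw [hg] at h1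
      have h2 := dist_triangle_left (g y) l y
      linarith
    · have : Filter.Tendsto (fun y : ℂ => 2 * dist y l) (𝓝 l) (𝓝 (2 * dist l l)) :=
        (by fun_prop : Continuous fun y : ℂ => 2 * dist y l).tendsto l
      simpa using this

theorem norm_sub_starProjection_le_gap (M L : Submodule ℂ H) [L.HasOrthogonalProjection]
    {χ : H} (hχ : χ ∈ M) : ‖χ - L.starProjection χ‖ ≤ gap M L * ‖χ‖ := by
  rcases eq_or_ne χ 0 with rfl | h0
  · simp
  have hn : ‖χ‖ ≠ 0 := norm_ne_zero_iff.2 h0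
  have hinf (ψ : H) : ‖ψ - L.starProjection ψ‖ ≤ Metric.infDist ψ (L : Set H) := by
    refine (Metric.le_infDist ⟨0, L.zero_mem⟩).2 fun y hy => ?_
    rw [Submodule.starProjection_minimal, dist_eq_norm]
    exact ciInf_le (f := fun x : L => ‖ψ - x‖) ⟨0, by rintro _ ⟨x, rfl⟩; exact norm_nonneg _⟩ ⟨y, hy⟩
  set ψ : H := ((‖χ‖⁻¹ : ℝ) : ℂ) • χ with hψ
  have hψ1 : ‖ψ‖ = 1 := by
    rw [hψ, norm_smul, Complex.norm_real, norm_inv, norm_norm, inv_mul_cancel₀ hn]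
  have hle : Metric.infDist ψ (L : Set H) ≤ gap M L := by
    refine le_csSup ⟨1, ?_⟩ ⟨ψ, ⟨M.smul_mem _ hχ, hψ1⟩, rfl⟩
    rintro _ ⟨y, ⟨-, hy⟩, rfl⟩
    have := Metric.infDist_le_dist_of_mem (x := y) (s := (L : Set H)) L.zero_mem
    rwa [dist_zero_right, hy] at this
  have h := (hinf ψ).trans hle
  rw [hψ, map_smul, ← smul_sub, norm_smul, Complex.norm_real, norm_inv, norm_norm] at h
  rw [inv_mul_le_iff₀ (by positivity)] at h
  linarith

theorem gap_nonneg (M L : Submodule ℂ H) : 0 ≤ gap M L :=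
  Real.sSup_nonneg fun _ ⟨_, _, h⟩ => h ▸ Metric.infDist_nonneg

variable [CompleteSpace H]

theorem isCompact_essSpectrum (A : H →L[ℂ] H) : IsCompact (essSpectrum A) := by
  refine (spectrum.isCompact A).of_isClosed_subset ?_ Set.sdiff_subset
  rw [← isOpen_compl_iff, isOpen_iff_mem_nhds]
  intro l hl
  by_cases hls : l ∈ spectrum ℂ A
  · have hd : l ∈ discreteSpectrum A := by
      by_contra h
      exact hl ⟨hls, h⟩
    obtain ⟨⟨r, hr, h⟩, -⟩ := id hd
    refine Filter.mem_of_superset (Metric.ball_mem_nhds l hr) fun y hy hye => ?_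
    have : y ∈ ({l} : Set ℂ) := h ▸ ⟨hy, hye.1⟩
    rw [Set.mem_singleton_iff] at this
    exact hye.2 (this ▸ hd)
  · refine Filter.mem_of_superset
      ((spectrum.isClosed A).isOpen_compl.mem_nhds hls) fun y hy hye => hy hye.1

theorem cfc_apply_mem_eigenspace {A : H →L[ℂ] H} (hA : IsStarNormal A) {k : ℂ → ℂ} {w : ℂ}
    (hk : ContinuousOn k (spectrum ℂ A)) (hkw : ∀ l, l ≠ w → k l = 0) (φ : H) :
    cfc k A φ ∈ eigenspace A w := by
  rw [eigenspace, Module.End.mem_eigenspace_iff]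
  have h : A * cfc k A = w • cfc k A := by
    nth_rewrite 1 [← cfc_id' ℂ A]
    rw [← cfc_mul (fun l => l) k A (by fun_prop) hk, ← cfc_const_mul w k A hk]
    congr 1
    funext l
    by_cases hl : l = w
    · rw [hl]
    · rw [hkw l hl, mul_zero, mul_zero]
  exact congrArg (fun T : H →L[ℂ] H => T φ) h

/-- A function of `A` supported on finitely many isolated eigenvalues maps into their
eigenspaces. -/
theorem cfc_apply_mem_eigenHull {A : H →L[ℂ] H} (hA : IsStarNormal A) {m : ℕ} {ζ : Fin m → ℂ}
    (hζ : Set.range ζ ⊆ discreteSpectrum A) {k : ℂ → ℂ}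
    (hk : ∀ l, l ∉ Set.range ζ → k l = 0) (φ : H) : cfc k A φ ∈ eigenHull A ζ := by
  classical
  have hcont (w : ℂ) (hw : w ∈ Set.range ζ) :
      ContinuousOn (fun l => if l = w then k l else 0) (spectrum ℂ A) := by
    have := continuousOn_ite_mem (A := A) (Z := {w}) (Set.singleton_subset_iff.2 (hζ hw))
      (Set.finite_singleton w) (continuousOn_const (c := (0 : ℂ))) k
    simpa only [Set.mem_singleton_iff] using this
  have hsum : k = ∑ w ∈ Finset.univ.image ζ, fun l => if l = w then k l else 0 := by
    funext l
    rw [Finset.sum_apply, Finset.sum_ite_eq]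
    split_ifs with h
    · rfl
    · exact hk l (by simpa using h)
  rw [hsum, cfc_sum _ A _ (fun w hw => hcont w (by simpa using hw)), _root_.sum_apply]
  refine Submodule.sum_mem _ fun w hw => ?_
  obtain ⟨j, rfl⟩ : w ∈ Set.range ζ := by simpa using hw
  exact (le_iSup (fun j => eigenspace A (ζ j)) j)
    (cfc_apply_mem_eigenspace hA (hcont _ ⟨j, rfl⟩) (fun l hl => if_neg hl) φ)

end SecondOrder

/-! ### Bounds on the constants and the multiplier -/

namespace SecondOrder

variable {H : Type*} [NormedAddCommGroup H] [InnerProductSpace ℂ H]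

theorem Q_empty : Q ∅ = ∅ := by
  ext z
  simp [Q, quadSet, closedConvexHull_eq_closure_convexHull]

/-- Expanding at `w` leaves two terms linear in `e - w` and one quadratic term; this is the source
of `2 M₀ f₁ + M₀²`. -/
theorem norm_quad_sub_quad_le (z w e : ℂ) :
    ‖quad z e - quad z w‖ ≤
      2 * ‖e - w‖ * max ‖z - w‖ ‖z - conj w‖ + ‖e - w‖ ^ 2 := by
  have h : quad z e - quad z w =
      (e - w) * (conj w - z) + (conj (e - w) * (w - z) + (e - w) * conj (e - w)) := by
    simp only [quad, map_sub]
    ring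
  have h1 := le_max_left ‖z - w‖ ‖z - conj w‖
  have h2 := le_max_right ‖z - w‖ ‖z - conj w‖
  rw [h]
  refine (norm_add_le _ _).trans ((add_le_add_right (norm_add_le _ _) _).trans ?_)
  rw [norm_mul, norm_mul, norm_mul, RCLike.norm_conj, norm_sub_rev (conj w), norm_sub_rev w z]
  nlinarith [mul_le_mul_of_nonneg_left h1 (norm_nonneg (e - w)),
    mul_le_mul_of_nonneg_left h2 (norm_nonneg (e - w))]

theorem M₀_nonneg (A : H →L[ℂ] H) {m : ℕ} (ζ : Fin m → ℂ) : 0 ≤ M₀ A ζ :=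
  Real.sSup_nonneg fun _ ⟨_, _, _, h⟩ => h ▸ norm_nonneg _

theorem f₁_nonneg {m : ℕ} (ζ : Fin m → ℂ) (z : ℂ) : 0 ≤ f₁ ζ z :=
  Real.iSup_nonneg fun _ => le_max_of_le_left (norm_nonneg _)

theorem f₂_nonneg {m : ℕ} (ζ : Fin m → ℂ) (z : ℂ) : 0 ≤ f₂ ζ z :=
  Real.iInf_nonneg fun _ => by positivity

theorem f₃_nonneg (A : H →L[ℂ] H) (z : ℂ) : 0 ≤ f₃ A z :=
  Real.sSup_nonneg fun _ ⟨_, _, h⟩ => h ▸ by positivity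

theorem f₄_nonneg (A : H →L[ℂ] H) (z : ℂ) : 0 ≤ f₄ A z :=
  Real.sInf_nonneg fun _ ⟨_, _, h⟩ => h ▸ by positivity

theorem α_nonneg (A : H →L[ℂ] H) {m : ℕ} (ζ : Fin m → ℂ) (z : ℂ) : 0 ≤ α A ζ z := by
  rw [α]
  split_ifs
  · exact zero_le_one
  · exact le_min zero_le_one (div_nonneg (f₂_nonneg ζ z) (f₃_nonneg A z))

theorem α_le_one (A : H →L[ℂ] H) {m : ℕ} (ζ : Fin m → ℂ) (z : ℂ) : α A ζ z ≤ 1 := by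
  rw [α]
  split_ifs
  · exact le_rfl
  · exact min_le_left _ _

theorem f₂_le {m : ℕ} (ζ : Fin m → ℂ) (z : ℂ) (j : Fin m) : f₂ ζ z ≤ ‖quad z (ζ j)‖ := by
  rw [norm_quad]
  exact ciInf_le (f := fun j => ‖z - ζ j‖ * ‖z - conj (ζ j)‖) (Set.finite_range _).bddBelow j

variable [CompleteSpace H]

theorem norm_quad_le_f₃ {A : H →L[ℂ] H} {e : ℂ} (he : e ∈ essSpectrum A) (z : ℂ) :
    ‖quad z e‖ ≤ f₃ A z := by
  rw [norm_quad]
  exact le_csSup ((isCompact_essSpectrum A).image (by fun_prop)).bddAbove ⟨e, he, rfl⟩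

theorem f₄_le_norm_quad {A : H →L[ℂ] H} {e : ℂ} (he : e ∈ essSpectrum A) (z : ℂ) :
    f₄ A z ≤ ‖quad z e‖ := by
  rw [norm_quad]
  exact csInf_le ((isCompact_essSpectrum A).image (by fun_prop)).bddBelow ⟨e, he, rfl⟩

theorem f₄_pos {A : H →L[ℂ] H} (hne : (essSpectrum A).Nonempty) {z : ℂ}
    (hz : ∀ l ∈ spectrum ℂ A, quad z l ≠ 0) : 0 < f₄ A z := by
  obtain ⟨e, he, h⟩ := (isCompact_essSpectrum A).exists_sInf_image_eq hne
    (f := fun e : ℂ => ‖z - e‖ * ‖z - conj e‖) (by fun_prop)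
  rw [f₄, h, ← norm_quad]
  exact norm_pos_iff.2 (hz e he.1)

theorem norm_sub_le_M₀ {A : H →L[ℂ] H} {e : ℂ} (he : e ∈ essSpectrum A) {m : ℕ} (ζ : Fin m → ℂ)
    (j : Fin m) : ‖e - ζ j‖ ≤ M₀ A ζ := by
  obtain ⟨R, hR⟩ := (isCompact_essSpectrum A).isBounded.exists_norm_le
  refine le_csSup ⟨R + ∑ i, ‖ζ i‖, ?_⟩ ⟨e, he, j, rfl⟩
  rintro _ ⟨e', he', i, rfl⟩
  exact (norm_sub_le _ _).trans (add_le_add (hR e' he')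
    (Finset.single_le_sum (f := fun i => ‖ζ i‖) (fun _ _ => norm_nonneg _) (Finset.mem_univ i)))

theorem α_mul_le {A : H →L[ℂ] H} {e : ℂ} (he : e ∈ essSpectrum A) {m : ℕ} {ζ : Fin m → ℂ}
    {z : ℂ} (j : Fin m) (h4 : 0 < f₄ A z) : α A ζ z * f₃ A z ≤ ‖quad z (ζ j)‖ := by
  have h3 : 0 < f₃ A z := h4.trans_le ((f₄_le_norm_quad he z).trans (norm_quad_le_f₃ he z))
  have hα : α A ζ z ≤ f₂ ζ z / f₃ A z := by
    rw [α, if_neg (Fin.pos j).ne']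
    exact min_le_right _ _
  exact ((le_div_iff₀ h3).1 hα).trans (f₂_le ζ z j)

/-- The factor `α` is chosen for this: it makes the multiplier `c` a contraction at the `z_j`. -/
theorem norm_α_mul_quad_div_le_one {A : H →L[ℂ] H} {e : ℂ} (he : e ∈ essSpectrum A) {m : ℕ}
    {ζ : Fin m → ℂ} {z : ℂ} (j : Fin m) (h4 : 0 < f₄ A z) :
    ‖(α A ζ z : ℂ) * quad z e / quad z (ζ j)‖ ≤ 1 := by
  rw [norm_div, norm_mul, Complex.norm_real, Real.norm_of_nonneg (α_nonneg A ζ z)]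
  exact div_le_one_of_le₀ ((mul_le_mul_of_nonneg_left (norm_quad_le_f₃ he z)
    (α_nonneg A ζ z)).trans (α_mul_le he j h4)) (norm_nonneg _)

/-- The difference is `α (q(e) - q(z_j)) / q(z_j)`, and `α f₄ ≤ α f₃ ≤ |q(z_j)|` lets `1 / f₄`
replace `α / |q(z_j)|`. -/
theorem norm_α_mul_quad_div_sub_le {A : H →L[ℂ] H} {e : ℂ} (he : e ∈ essSpectrum A) {m : ℕ}
    {ζ : Fin m → ℂ} {z : ℂ} (j : Fin m) (h4 : 0 < f₄ A z) (hq : quad z (ζ j) ≠ 0) :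
    ‖(α A ζ z : ℂ) * quad z e / quad z (ζ j) - α A ζ z‖ ≤
      (2 * M₀ A ζ * f₁ ζ z + M₀ A ζ ^ 2) / f₄ A z := by
  have hf₁ : max ‖z - ζ j‖ ‖z - conj (ζ j)‖ ≤ f₁ ζ z :=
    le_ciSup (f := fun j => max ‖z - ζ j‖ ‖z - conj (ζ j)‖) (Set.finite_range _).bddAbove j
  have hM := norm_sub_le_M₀ he ζ j
  have hM0 := M₀_nonneg A ζ
  have hα := α_nonneg A ζ z
  have hdiff : ‖quad z e - quad z (ζ j)‖ ≤ 2 * M₀ A ζ * f₁ ζ z + M₀ A ζ ^ 2 := by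
    refine (norm_quad_sub_quad_le z (ζ j) e).trans ?_
    gcongr
  have hαf : α A ζ z * f₄ A z ≤ ‖quad z (ζ j)‖ :=
    (mul_le_mul_of_nonneg_left ((f₄_le_norm_quad he z).trans (norm_quad_le_f₃ he z)) hα).trans
      (α_mul_le he j h4)
  rw [mul_div_assoc, ← mul_sub_one, div_sub_one hq, norm_mul, norm_div, Complex.norm_real,
    Real.norm_of_nonneg hα, mul_div_assoc', div_le_div_iff₀ (norm_pos_iff.2 hq) h4]
  calc α A ζ z * ‖quad z e - quad z (ζ j)‖ * f₄ A z
      = ‖quad z e - quad z (ζ j)‖ * (α A ζ z * f₄ A z) := by ring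
    _ ≤ _ := mul_le_mul hdiff hαf (mul_nonneg hα h4.le) ((norm_nonneg _).trans hdiff)

theorem quad_ne_zero {A : H →L[ℂ] H} {z : ℂ} (h1 : z ∉ spectrum ℂ A)
    (h2 : z ∉ spectrum ℂ (ContinuousLinearMap.adjoint A)) {l : ℂ} (hl : l ∈ spectrum ℂ A) :
    quad z l ≠ 0 := by
  refine mul_ne_zero (sub_ne_zero.2 fun h => h1 (h ▸ hl)) (sub_ne_zero.2 fun h => h2 ?_)
  rw [← ContinuousLinearMap.star_eq_adjoint, spectrum.map_star, ← h, Set.mem_star]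
  simpa using hl

/-! ### The compression estimate -/

/-- The compression estimate in terms of a nearest point map `g` onto the essential spectrum. -/
theorem α_mul_le_norm_starProjection_add {A : H →L[ℂ] H} (hA : IsStarNormal A)
    (L : Submodule ℂ H) [L.HasOrthogonalProjection] {ε : ℝ} (hε : 0 ≤ ε) {m : ℕ} {ζ : Fin m → ℂ}
    (hζ : spectrum ℂ A \ Metric.cthickening ε (essSpectrum A) = Set.range ζ)
    (hne : (essSpectrum A).Nonempty) {z : ℂ} (hz : ∀ l ∈ spectrum ℂ A, quad z l ≠ 0)
    {φ : H} (hφ : φ ∈ L) :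
    α A ζ z * distQ A ε z ^ 2 * ‖φ‖ ^ 2 ≤ ‖φ‖ * ‖L.starProjection (quadOp A z φ)‖ +
      gap (eigenHull A ζ) L * ((2 * M₀ A ζ * f₁ ζ z + M₀ A ζ ^ 2) / f₄ A z) * ‖quadOp A z‖ *
        ‖φ‖ ^ 2 := by
  classical
  choose g hgS hg using (isCompact_essSpectrum A).exists_infDist_eq_dist hne
  have h4 := f₄_pos hne hz
  set a := α A ζ z with ha
  set b := (2 * M₀ A ζ * f₁ ζ z + M₀ A ζ ^ 2) / f₄ A z with hb
  have hb0 : 0 ≤ b := by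
    have := M₀_nonneg A ζ
    have := f₁_nonneg ζ z
    positivity
  have hζσ : Set.range ζ ⊆ spectrum ℂ A := hζ ▸ Set.sdiff_subset
  have hζd : Set.range ζ ⊆ discreteSpectrum A := by
    intro l hl
    by_contra h
    have hl' := hl
    rw [← hζ] at hl'
    exact hl'.2 (Metric.self_subset_cthickening _ ⟨hζσ hl, h⟩)
  set f : ℂ → ℂ := fun l => if l ∈ Set.range ζ then g l else l with hf
  have hgc : ContinuousOn g (spectrum ℂ A) := continuousOn_of_infDist_eq_dist hg
  have hfc : ContinuousOn f (spectrum ℂ A) :=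
    continuousOn_ite_mem hζd (Set.finite_range ζ) continuousOn_id g
  have hf_on {l : ℂ} (hl : l ∈ Set.range ζ) : f l = g l := if_pos hl
  have hf_off {l : ℂ} (hl : l ∉ Set.range ζ) : f l = l := if_neg hl
  have hfg : ∀ l ∈ spectrum ℂ A, ‖f l - g l‖ ≤ ε := by
    intro l hl
    by_cases hlZ : l ∈ Set.range ζ
    · rwa [hf_on hlZ, sub_self, norm_zero]
    · have hc : l ∈ Metric.cthickening ε (essSpectrum A) := by
        by_contra h
        exact hlZ (hζ ▸ ⟨hl, h⟩)
      rw [hf_off hlZ, ← dist_eq_norm, ← hg]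
      rw [Metric.mem_cthickening_iff] at hc
      exact ENNReal.toReal_le_of_le_ofReal hε hc
  have hqf : ContinuousOn (fun l => quad z (f l)) (spectrum ℂ A) :=
    (continuous_quad z).comp_continuousOn hfc
  have hform := sq_infDist_le_norm_inner_cfc_quad hA hfc hgc (fun l _ => hgS l) hε hfg z φ
  set c : ℂ → ℂ := fun l => (a : ℂ) * quad z (f l) / quad z l with hc
  have hcc : ContinuousOn c (spectrum ℂ A) :=
    (continuousOn_const.mul hqf).div (continuous_quad z).continuousOn hz
  have hc_off {l : ℂ} (hl : l ∈ spectrum ℂ A) (hlZ : l ∉ Set.range ζ) : c l = a := by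
    simp only [hc, hf_off hlZ]
    exact mul_div_cancel_right₀ _ (hz l hl)
  have hc1 : ∀ l ∈ spectrum ℂ A, ‖c l‖ ≤ 1 := by
    intro l hl
    by_cases hlZ : l ∈ Set.range ζ
    · have := hlZ
      obtain ⟨j, rfl⟩ := this
      simp only [hc, hf_on hlZ]
      exact norm_α_mul_quad_div_le_one (hgS _) j h4
    · rw [hc_off hl hlZ, Complex.norm_real, Real.norm_of_nonneg (α_nonneg A ζ z)]
      exact α_le_one A ζ z
  -- `k` is `star c - α` on the spectrum, cut off to vanish identically off the `z_j`, so that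
  -- `k(A)` maps into the eigenspace hull.
  set k : ℂ → ℂ := fun l => if l ∈ Set.range ζ then star (c l) - a else 0 with hk
  have hkc : ContinuousOn k (spectrum ℂ A) :=
    continuousOn_ite_mem hζd (Set.finite_range ζ) continuousOn_const _
  have hk_on {l : ℂ} (hl : l ∈ Set.range ζ) : k l = star (c l) - a := if_pos hl
  have hk_off {l : ℂ} (hl : l ∉ Set.range ζ) : k l = 0 := if_neg hl
  have hkb : ∀ l ∈ spectrum ℂ A, ‖k l‖ ≤ b := by
    intro l hl
    by_cases hlZ : l ∈ Set.range ζ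
    · have := hlZ
      obtain ⟨j, rfl⟩ := this
      have hs : star (c (ζ j)) - a = star (c (ζ j) - a) := by simp
      rw [hk_on hlZ, hs, norm_star]
      simp only [hc, hf_on hlZ]
      exact norm_α_mul_quad_div_sub_le (hgS _) j h4 (hz _ hl)
    · rwa [hk_off hlZ, norm_zero]
  have hstar : star (cfc c A) = cfc k A + algebraMap ℂ (H →L[ℂ] H) a := by
    rw [← cfc_star, ← cfc_const (a : ℂ) A, ← cfc_add A k _ hkc continuousOn_const]
    refine cfc_congr fun l hl => ?_
    by_cases hlZ : l ∈ Set.range ζ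
    · rw [hk_on hlZ, sub_add_cancel]
    · rw [hk_off hlZ, hc_off hl hlZ, zero_add, Complex.star_def, Complex.conj_ofReal]
  have hmul : cfc c A * quadOp A z = (a : ℂ) • cfc (fun l => quad z (f l)) A := by
    rw [quadOp_eq_cfc hA, ← cfc_mul c (quad z) A hcc (continuous_quad z).continuousOn,
      ← cfc_const_mul _ _ A hqf]
    exact cfc_congr fun l hl => div_mul_cancel₀ _ (hz l hl)
  set χ := cfc k A φ with hχ
  set u := star (cfc c A) φ with hu
  have huχ : u = χ + (a : ℂ) • φ := by
    rw [hu, hstar]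
    rfl
  have hun : ‖u‖ ≤ ‖φ‖ := by
    refine (ContinuousLinearMap.le_opNorm _ _).trans ?_
    rw [norm_star]
    exact mul_le_of_le_one_left (norm_nonneg _) (norm_cfc_le zero_le_one hc1)
  have hχn : ‖χ‖ ≤ b * ‖φ‖ := (ContinuousLinearMap.le_opNorm _ _).trans
    (mul_le_mul_of_nonneg_right (norm_cfc_le hb0 hkb) (norm_nonneg _))
  -- The part `α φ` lies in `L` and drops out, leaving only the component in the hull.
  have hsub : u - L.starProjection u = χ - L.starProjection χ := by
    rw [huχ, map_add, map_smul, Submodule.starProjection_eq_self_iff.2 hφ]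
    abel
  have hgap : ‖u - L.starProjection u‖ ≤ gap (eigenHull A ζ) L * (b * ‖φ‖) := by
    rw [hsub]
    exact (norm_sub_starProjection_le_gap (eigenHull A ζ) L
      (cfc_apply_mem_eigenHull hA hζd (fun _ => hk_off) φ)).trans
      (mul_le_mul_of_nonneg_left hχn (gap_nonneg _ _))
  have hinner : inner ℂ u (quadOp A z φ) =
      (a : ℂ) * inner ℂ φ (cfc (fun l => quad z (f l)) A φ) := by
    rw [hu, ContinuousLinearMap.star_eq_adjoint, ContinuousLinearMap.adjoint_inner_left,
      ← mul_apply_eq_comp, hmul, _root_.smul_apply, inner_smul_right]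
  have hsplit : inner ℂ u (quadOp A z φ) = inner ℂ u (L.starProjection (quadOp A z φ)) +
      inner ℂ (u - L.starProjection u) (quadOp A z φ) := by
    rw [← Submodule.inner_starProjection_left_eq_right, ← inner_add_left]
    congr 1
    abel
  calc a * distQ A ε z ^ 2 * ‖φ‖ ^ 2
      = a * (distQ A ε z ^ 2 * ‖φ‖ ^ 2) := by ring
    _ ≤ a * ‖inner ℂ φ (cfc (fun l => quad z (f l)) A φ)‖ :=
        mul_le_mul_of_nonneg_left hform (α_nonneg A ζ z)
    _ = ‖inner ℂ u (quadOp A z φ)‖ := by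
        rw [hinner, norm_mul, Complex.norm_real, Real.norm_of_nonneg (α_nonneg A ζ z)]
    _ ≤ ‖u‖ * ‖L.starProjection (quadOp A z φ)‖ +
          ‖u - L.starProjection u‖ * ‖quadOp A z φ‖ := by
        rw [hsplit]
        exact (norm_add_le _ _).trans (add_le_add (norm_inner_le_norm _ _) (norm_inner_le_norm _ _))
    _ ≤ ‖φ‖ * ‖L.starProjection (quadOp A z φ)‖ +
          gap (eigenHull A ζ) L * (b * ‖φ‖) * (‖quadOp A z‖ * ‖φ‖) :=
        add_le_add (mul_le_mul_of_nonneg_right hun (norm_nonneg _))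
          (mul_le_mul hgap (ContinuousLinearMap.le_opNorm _ _) (norm_nonneg _)
            ((norm_nonneg _).trans hgap))
    _ = _ := by ring

end SecondOrder

theorem mainTheorem4 {H : Type*} [NormedAddCommGroup H] [InnerProductSpace ℂ H] [CompleteSpace H]
    (hH : ¬ FiniteDimensional ℂ H)
    (A : H →L[ℂ] H) (hA : IsStarNormal A)
    (L : Submodule ℂ H) [FiniteDimensional ℂ L]
    (ε : ℝ) (hε : 0 < ε)
    (m : ℕ) (ζ : Fin m → ℂ)
    (hζ : spectrum ℂ A \ Metric.cthickening ε (SecondOrder.essSpectrum A) = Set.range ζ)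
    (z : ℂ)
    (hz : z ∉ spectrum ℂ A ∪ spectrum ℂ (ContinuousLinearMap.adjoint A) ∪
      Metric.cthickening ε (SecondOrder.Q (SecondOrder.essSpectrum A)))
    (ψ : H) :
    ‖L.starProjection (SecondOrder.quadOp A z (L.starProjection ψ))‖ ≥
      SecondOrder.distQ A ε z ^ 2 *
        (SecondOrder.α A ζ z -
          SecondOrder.β A ε ζ z * SecondOrder.gap (SecondOrder.eigenHull A ζ) L) *
        ‖L.starProjection ψ‖ := by
  open SecondOrder in
  -- This covers an empty essential spectrum: then `Q` is empty and `infDist` takes its default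
  -- value `0`, so the right side vanishes.
  rcases eq_or_ne (distQ A ε z) 0 with hd | hd
  · simp [hd]
  have hne : (essSpectrum A).Nonempty := by
    by_contra h
    refine hd ?_
    rw [distQ, Set.not_nonempty_iff_eq_empty.1 h, Q_empty, Metric.cthickening_empty,
      Metric.infDist_empty]
  set φ := L.starProjection ψ with hφ
  have hq : ∀ l ∈ spectrum ℂ A, quad z l ≠ 0 := fun l hl =>
    quad_ne_zero (fun h => hz (Or.inl (Or.inl h))) (fun h => hz (Or.inl (Or.inr h))) hl
  have key := α_mul_le_norm_starProjection_add hA L hε.le hζ hne hq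
    (φ := φ) (Submodule.starProjection_apply_mem L ψ)
  set b := (2 * M₀ A ζ * f₁ ζ z + M₀ A ζ ^ 2) / f₄ A z with hb
  have hb0 : 0 ≤ b := by
    have := M₀_nonneg A ζ
    have := f₁_nonneg ζ z
    have := f₄_nonneg A z
    positivity
  have hβ : distQ A ε z ^ 2 * β A ε ζ z = b * distQ A ε z ^ 2 + b * ‖quadOp A z‖ := by
    rw [β, ← hb]
    field_simp
  have hδ := gap_nonneg (eigenHull A ζ) L
  rcases (norm_nonneg φ).eq_or_lt with h0 | h0
  · rw [← h0, mul_zero]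
    exact norm_nonneg _
  refine le_of_mul_le_mul_left ?_ h0
  -- The summand `1` in `β` is slack: the estimate already holds with only the operator norm term.
  have hextra : 0 ≤ gap (eigenHull A ζ) L * (b * distQ A ε z ^ 2) * ‖φ‖ ^ 2 := by positivity
  calc ‖φ‖ * (distQ A ε z ^ 2 * (α A ζ z - β A ε ζ z * gap (eigenHull A ζ) L) * ‖φ‖)
      = α A ζ z * distQ A ε z ^ 2 * ‖φ‖ ^ 2 -
          gap (eigenHull A ζ) L * (distQ A ε z ^ 2 * β A ε ζ z) * ‖φ‖ ^ 2 := by ring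
    _ ≤ ‖φ‖ * ‖L.starProjection (quadOp A z φ)‖ := by
        rw [hβ]
        linarith
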